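/- Let $k$ be a field and let $\mathcal A$ be a $k$-linear Abelian category that is semisimple, that is, every object of $\mathcal A$ is a finite direct sum of simple objects. Let $Q$ be a $\mathbb Z^1$-quiver and let $\mathfrak V$ be a locally finite exact linked net over $Q$ of objects in $\mathcal A$. Then $\mathfrak V$ is isomorphic, as a representation of $Q$, to a (possibly empty) finite direct sum $\mathfrak W_1\oplus\dots\oplus\mathfrak W_m$ of simple locally finite exact linked nets $\mathfrak W_i$ over $Q$ of objects in $\mathcal A$. The terms are as follows. Let $n>0$ and let $Q$ be a quiver with a partition of its set of arrows into $n+1$ nonempty parts, the arrow types. The type of a path is the function giving, for each arrow type, the number of arrows of that type in the path. A path is admissible if it contains no arrow of some type, and simple if it contains at most one arrow of each type. A maximal simple path, that is, a simple path that is not a proper part of a longer simple path, is called a minimal circuit. The quiver $Q$, with this partition, is a $\mathbb Z^n$-quiver if: (1) exactly one arrow of each type leaves each vertex; (2) each vertex is connected to each other vertex by an admissible path; (3) each maximal simple path is a circuit, that is, it ends where it starts; (4) two admissible paths leaving the same vertex arrive at the same vertex if and only if they have the same type. Distinct vertices $u,v$ are neighbors if an admissible simple path connects $u$ to $v$. For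 a representation $\mathfrak V$ of $Q$ in $\mathcal A$, with objects $V_v$, let $\varphi_\gamma$ be the composition of the maps along a path $\gamma$ (the identity if $\gamma$ is trivial). Then: - $\mathfrak V$ is a linked net if (1) whenever $\gamma_1,\gamma_2$ are two paths connecting the same two vertices and $\gamma_2$ is admissible, $\varphi_{\gamma_1}=c\,\varphi_{\gamma_2}$ for some $c\in k$; (2) $\varphi_\gamma=0$ for each minimal circuit $\gamma$; (3) $\operatorname{Ker}(\varphi_{\gamma_1})\cap\operatorname{Ker}(\varphi_{\gamma_2})=0$ whenever $\gamma_1,\gamma_2$ are admissible paths leaving the same vertex with no arrow type in common. - A linked net $\mathfrak V$ is exact if $\operatorname{Ker}(\varphi_\gamma)=\operatorname{Im}(\varphi_\mu)$ for all neighbors $u,v$ and all admissible paths $\gamma$ from $u$ to $v$ and $\mu$ from $v$ to $u$. - $\mathfrak V$ is locally finite if for each vertex $v$ there is an integer $\ell$ such that $\varphi_\mu=0$ for every path $\mu$ arriving at $v$ of length greater than $\ell$. - $\mathfrak V$ is simple if each object $V_v$ is a simple object of $\mathcal A$. -/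

import Mathlib

open CategoryTheory CategoryTheory.Limits

namespace LinkedNets

attribute [local instance] Abelian.hasFiniteBiproducts

universe w u v' u'

/-! ### Quivers with a partition of the arrows -/

/-- A partition of the arrows of a quiver into `n + 1` nonempty parts `A_0, …, A_n` (the
"arrow types"), given by the function that sends an arrow to the index of its part. -/
structure ArrowPartition (Q : Type u) [Quiver.{w} Q] (n : ℕ) where
  type : ∀ {a b : Q}, (a ⟶ b) → Fin (n + 1)
  exists_arrow : ∀ i : Fin (n + 1), ∃ (a b : Q) (e : a ⟶ b), type e = i

namespace ArrowPartition

variable {Q : Type u} [Quiver.{w} Q] {n : ℕ} (T : ArrowPartition Q n)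

/-- The type of a path: the number of arrows of each type that it contains. -/
def pathType {a : Q} : ∀ {b : Q}, Quiver.Path a b → Fin (n + 1) → ℕ
  | _, .nil => fun _ => 0
  | _, .cons γ e => fun i => pathType γ i + if T.type e = i then 1 else 0

/-- A path is admissible if it contains no arrow of a certain type. -/
def Admissible {a b : Q} (γ : Quiver.Path a b) : Prop := ∃ i, T.pathType γ i = 0

/-- A path is simple if it contains at most one arrow of each type. -/
def SimplePath {a b : Q} (γ : Quiver.Path a b) : Prop := ∀ i, T.pathType γ i ≤ 1

/-- A maximal simple path: a simple path that is not a proper part of another simple path. -/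
def MaximalSimplePath {a b : Q} (γ : Quiver.Path a b) : Prop :=
  T.SimplePath γ ∧
    ∀ {c d : Q} (α : Quiver.Path c a) (β : Quiver.Path b d),
      T.SimplePath ((α.comp γ).comp β) → α.length = 0 ∧ β.length = 0

end ArrowPartition

/-- A `ℤⁿ`-structure on a quiver, `n > 0`. -/
structure ZStructure (Q : Type u) [Quiver.{w} Q] (n : ℕ) extends ArrowPartition Q n where
  pos : 0 < n
  /-- There is exactly one arrow of each type leaving each vertex. -/
  existsUnique_arrow : ∀ (a : Q) (i : Fin (n + 1)), ∃! e : Σ b : Q, (a ⟶ b), type e.2 = i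
  /-- Each vertex is connected to each other by an admissible path. -/
  exists_admissible : ∀ a b : Q, ∃ γ : Quiver.Path a b, toArrowPartition.Admissible γ
  /-- Each maximal simple path is a circuit. -/
  circuit : ∀ {a b : Q} (γ : Quiver.Path a b), toArrowPartition.MaximalSimplePath γ → a = b
  /-- Two admissible paths leaving the same vertex arrive at the same vertex if and only if they
  are of the same type. -/
  end_eq_iff : ∀ {a b c : Q} (γ₁ : Quiver.Path a b) (γ₂ : Quiver.Path a c),
    toArrowPartition.Admissible γ₁ → toArrowPartition.Admissible γ₂ →
      (b = c ↔ toArrowPartition.pathType γ₁ = toArrowPartition.pathType γ₂)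

namespace ZStructure

variable {Q : Type u} [Quiver.{w} Q] {n : ℕ} (S : ZStructure Q n)

/-- The minimal circuits are the maximal simple paths. -/
abbrev MinimalCircuit {a b : Q} (γ : Quiver.Path a b) : Prop :=
  S.toArrowPartition.MaximalSimplePath γ

/-- Distinct vertices are neighbors if an admissible simple path connects the first to the
second. -/
def Neighbors (a b : Q) : Prop :=
  a ≠ b ∧ ∃ γ : Quiver.Path a b, S.Admissible γ ∧ S.SimplePath γ

end ZStructure

/-! ### Representations -/

section Rep

variable {Q : Type u} [Quiver.{w} Q] {A : Type u'} [Category.{v'} A]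

/-- The composition of the maps that a representation of a quiver associates to the arrows of a
path; the identity for the trivial path. -/
def pathMap (V : Q ⥤q A) {a : Q} : ∀ {b : Q}, Quiver.Path a b → (V.obj a ⟶ V.obj b)
  | _, .nil => 𝟙 (V.obj a)
  | _, .cons γ e => pathMap V γ ≫ V.map e

/-- An isomorphism of representations. -/
structure RepIso (V W : Q ⥤q A) where
  iso : ∀ a : Q, V.obj a ≅ W.obj a
  comm : ∀ {a b : Q} (e : a ⟶ b), V.map e ≫ (iso b).hom = (iso a).hom ≫ W.map e

variable [Abelian A]

/-- The direct sum of finitely many representations, formed at each vertex and arrow. -/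
noncomputable def directSum {m : ℕ} (W : Fin m → (Q ⥤q A)) : Q ⥤q A where
  obj a := ⨁ fun i => (W i).obj a
  map e := biproduct.map fun i => (W i).map e

/-- For each vertex, the maps along all sufficiently long paths arriving at it vanish. -/
def LocallyFiniteNet (V : Q ⥤q A) : Prop :=
  ∀ b : Q, ∃ l : ℕ, ∀ (a : Q) (γ : Quiver.Path a b), l < γ.length → pathMap V γ = 0

/-- All associated objects are simple objects of the category. -/
def SimpleNet (V : Q ⥤q A) : Prop := ∀ a : Q, Simple (V.obj a)

variable {n : ℕ} (S : ZStructure Q n) (k : Type*) [Field k] [Linear k A]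

/-- Weakly linked nets over a `ℤⁿ`-quiver. -/
structure IsWeaklyLinkedNet (V : Q ⥤q A) : Prop where
  smul : ∀ {a b : Q} (γ₁ γ₂ : Quiver.Path a b), S.Admissible γ₂ →
    ∃ c : k, pathMap V γ₁ = c • pathMap V γ₂
  circuit : ∀ {a b : Q} (γ : Quiver.Path a b), S.MinimalCircuit γ → pathMap V γ = 0

/-- Linked nets over a `ℤⁿ`-quiver. -/
structure IsLinkedNet (V : Q ⥤q A) : Prop extends IsWeaklyLinkedNet S k V where
  ker_inf_ker : ∀ {a b c : Q} (γ₁ : Quiver.Path a b) (γ₂ : Quiver.Path a c),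
    S.Admissible γ₁ → S.Admissible γ₂ →
    (∀ i, S.pathType γ₁ i = 0 ∨ S.pathType γ₂ i = 0) →
      kernelSubobject (pathMap V γ₁) ⊓ kernelSubobject (pathMap V γ₂) = ⊥

/-- Exactness: for neighboring vertices `a` and `b`, the kernel of the map from `a` to `b` equals
the image of the map from `b` to `a`, the maps being those along admissible paths (which for a
weakly linked net depend only on the vertices, up to nonzero scalars). -/
def ExactNet (V : Q ⥤q A) : Prop :=
  ∀ {a b : Q}, S.Neighbors a b → ∀ (γ : Quiver.Path a b) (μ : Quiver.Path b a),
    S.Admissible γ → S.Admissible μ →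
      kernelSubobject (pathMap V γ) = imageSubobject (pathMap V μ)

end Rep

/-- An Abelian category is semisimple if every object is a finite direct sum of simple objects. -/
def SemisimpleCategory (A : Type u') [Category.{v'} A] [Abelian A] : Prop :=
  ∀ X : A, ∃ (m : ℕ) (Y : Fin m → A), (∀ i, Simple (Y i)) ∧ Nonempty (X ≅ ⨁ Y)

end LinkedNets

open LinkedNets

open CategoryTheory CategoryTheory.Limits

namespace LinkedNets

attribute [local instance] Abelian.hasFiniteBiproducts

universe w u v' u'

/-! ### Semisimple categories -/

section Semisimple

variable {A : Type u'} [Category.{v'} A] [Abelian A]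

/-! The vertices of a `ℤ¹`-quiver are the integers: arrows of type `1` raise the degree by one,
arrows of type `0` lower it, and any two vertices are joined by exactly one admissible path
(`exists_degree`, `eq_of_admissible`). An exact linked net therefore yields maps `p a b` that
compose when the middle vertex lies between the outer two, and compose to zero otherwise
(`IsExactSystem`).

At each vertex `a`, choose a complement to the sum of the images of the two adjacent vertices and
split it into simple objects `Y t`, with `d t = a`. Transported along the maps `p (d t)`, each `Y t`
generates a copy of `principalNet`, and the net is the direct sum of these copies. Injectivity at
each vertex (`Independent.mono_sumMap`) comes from exactness and the trivial intersections of
kernels. Surjectivity (`Generating.epi_sumMap`) comes from replacing an element by elements ever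
farther away, until local finiteness kills the remainder. Local finiteness at a single vertex also
leaves only finitely many nonzero complements (`NeighborComplement.isZero`).

Every object is projective, so generalized elements `T ⟶ V a` can be lifted and handled like
elements of modules. -/

/-- Some component of `e` on a simple summand of `E` is nonzero, hence invertible by Schur's lemma.
-/
theorem SemisimpleCategory.exists_section (hA : SemisimpleCategory A) {E Y : A} [Simple Y]
    (e : E ⟶ Y) [Epi e] : ∃ s : Y ⟶ E, s ≫ e = 𝟙 Y := by
  obtain ⟨m, X, hX, ⟨φ⟩⟩ := hA E
  have he : ∃ i, biproduct.ι X i ≫ φ.inv ≫ e ≠ 0 := by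
    by_contra! h
    have h0 : φ.inv ≫ e = 0 := biproduct.hom_ext' _ _ fun i => by simpa using h i
    have h1 : e = 0 := by simpa using congrArg (φ.hom ≫ ·) h0
    subst h1
    exact Simple.not_isZero Y (IsZero.of_epi_eq_zero (0 : E ⟶ Y) rfl)
  obtain ⟨i, hi⟩ := he
  have := hX i
  have := isIso_of_hom_simple hi
  exact ⟨inv (biproduct.ι X i ≫ φ.inv ≫ e) ≫ biproduct.ι X i ≫ φ.inv, by simp⟩

/-- The pullback of an epimorphism to `Y` is again an epimorphism, and it has a section. -/
theorem SemisimpleCategory.projective_of_simple (hA : SemisimpleCategory A) (Y : A) [Simple Y] :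
    Projective Y where
  factors f e _ := by
    obtain ⟨s, hs⟩ := hA.exists_section (pullback.fst f e)
    exact ⟨s ≫ pullback.snd f e, by
      rw [Category.assoc, ← pullback.condition, reassoc_of% hs]⟩

theorem SemisimpleCategory.projective (hA : SemisimpleCategory A) (X : A) : Projective X := by
  obtain ⟨m, Y, hY, ⟨φ⟩⟩ := hA X
  have : ∀ i, Projective (Y i) := fun i => hA.projective_of_simple (Y i)
  have : Projective (⨁ Y) := ⟨fun f e _ =>
    ⟨biproduct.desc fun i => Projective.factorThru (biproduct.ι Y i ≫ f) e,
      biproduct.hom_ext' _ _ fun i => by simp⟩⟩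
  exact Projective.of_iso φ.symm this

theorem exists_lift_of_kernel_eq_image {X Y Z T : A} [Projective T] {f : Y ⟶ Z} {g : X ⟶ Y}
    (h : kernelSubobject f = imageSubobject g) (x : T ⟶ Y) (hx : x ≫ f = 0) :
    ∃ y : T ⟶ X, y ≫ g = x := by
  have hfac : (imageSubobject g).Factors x := h ▸ kernelSubobject_factors f x hx
  obtain ⟨y, hy⟩ := Projective.factors ((imageSubobject g).factorThru x hfac)
    (factorThruImageSubobject g)
  refine ⟨y, ?_⟩
  rw [← Subobject.factorThru_arrow _ x hfac, ← hy, Category.assoc, imageSubobject_arrow_comp]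

theorem eq_zero_of_kernel_inf_kernel {X Y Z T : A} {f : X ⟶ Y} {g : X ⟶ Z}
    (h : kernelSubobject f ⊓ kernelSubobject g = ⊥) (x : T ⟶ X) (hf : x ≫ f = 0)
    (hg : x ≫ g = 0) : x = 0 := by
  have hfac : (kernelSubobject f ⊓ kernelSubobject g).Factors x :=
    (Subobject.inf_factors x).2 ⟨kernelSubobject_factors f x hf, kernelSubobject_factors g x hg⟩
  rw [h] at hfac
  exact Subobject.bot_factors_iff_zero _ |>.1 hfac

end Semisimple

/-! ### Paths in a `ℤ¹`-quiver -/

section Paths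

variable {Q : Type u} [Quiver.{w} Q]

theorem ArrowPartition.pathType_comp {n : ℕ} (T : ArrowPartition Q n) {a b c : Q}
    (γ : Quiver.Path a b) (δ : Quiver.Path b c) (i : Fin (n + 1)) :
    T.pathType (γ.comp δ) i = T.pathType γ i + T.pathType δ i := by
  induction δ with
  | nil => simp [pathType]
  | cons δ e ih => simp [pathType, ih, add_assoc]

theorem ArrowPartition.sum_pathType {n : ℕ} (T : ArrowPartition Q n) {a b : Q}
    (γ : Quiver.Path a b) : ∑ i, T.pathType γ i = γ.length := by
  induction γ with
  | nil => simp [pathType]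
  | cons γ e ih => simp [pathType, Finset.sum_add_distrib, ih]

theorem pathMap_comp {A : Type u'} [Category.{v'} A] (V : Q ⥤q A) {a b c : Q}
    (γ : Quiver.Path a b) (δ : Quiver.Path b c) :
    pathMap V (γ.comp δ) = pathMap V γ ≫ pathMap V δ := by
  induction δ with
  | nil => simp [pathMap]
  | cons δ e ih => simp [pathMap, ih]

namespace ZStructure

theorem sigma_eq_of_type_eq {n : ℕ} (S : ZStructure Q n) {a b c : Q} (e : a ⟶ b) (e' : a ⟶ c)
    (h : S.type e = S.type e') : (⟨b, e⟩ : Σ b : Q, (a ⟶ b)) = ⟨c, e'⟩ :=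
  (S.existsUnique_arrow a (S.type e)).unique rfl h.symm

variable (S : ZStructure Q 1)

theorem admissible_iff {a b : Q} (γ : Quiver.Path a b) :
    S.Admissible γ ↔ S.pathType γ 0 = 0 ∨ S.pathType γ 1 = 0 := by
  simp [ArrowPartition.Admissible, Fin.exists_fin_two]

theorem simplePath_iff {a b : Q} (γ : Quiver.Path a b) :
    S.SimplePath γ ↔ S.pathType γ 0 ≤ 1 ∧ S.pathType γ 1 ≤ 1 := by
  simp [ArrowPartition.SimplePath, Fin.forall_fin_two]

theorem length_eq {a b : Q} (γ : Quiver.Path a b) :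
    γ.length = S.pathType γ 0 + S.pathType γ 1 := by
  rw [← S.sum_pathType γ, Fin.sum_univ_two]

/-- A simple path that misses a type can be prolonged by the arrow of that type leaving its end. -/
theorem minimalCircuit_iff {a b : Q} (γ : Quiver.Path a b) :
    S.MinimalCircuit γ ↔ S.pathType γ 0 = 1 ∧ S.pathType γ 1 = 1 := by
  constructor
  · rintro ⟨h, hmax⟩
    rw [simplePath_iff] at h
    have key : ∀ i : Fin 2, S.pathType γ i ≠ 0 := by
      intro i hi
      obtain ⟨⟨c, e⟩, he, -⟩ := S.existsUnique_arrow b i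
      have := hmax Quiver.Path.nil e.toPath (by
        intro j
        have hj : S.pathType γ j ≤ 1 := by fin_cases j <;> simp [h]
        simp only [ArrowPartition.pathType_comp, Quiver.Hom.toPath, ArrowPartition.pathType]
        split_ifs with hij
        · have : j = i := by rw [← hij]; exact he
          subst this; omega
        · omega)
      simp at this
    have h0 := key 0
    have h1 := key 1
    omega
  · rintro ⟨h0, h1⟩
    refine ⟨(S.simplePath_iff γ).2 (by omega), fun α β h => ?_⟩
    rw [simplePath_iff] at h
    simp only [ArrowPartition.pathType_comp] at h
    rw [S.length_eq, S.length_eq]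
    omega

/-- Paths leaving the same vertex with all arrows of the same type and equally many of them are
equal. -/
theorem sigma_path_eq (i : Fin 2) {a b c : Q} (γ : Quiver.Path a b) (δ : Quiver.Path a c)
    (hγ : S.pathType γ i = 0) (hδ : S.pathType δ i = 0) (h : S.pathType γ = S.pathType δ) :
    (⟨b, γ⟩ : Σ b : Q, Quiver.Path a b) = ⟨c, δ⟩ := by
  have hlen : γ.length = δ.length := by rw [S.length_eq, S.length_eq, h]
  clear h
  induction γ generalizing c with
  | nil =>
    cases δ with
    | nil => rfl
    | cons δ e => simp at hlen
  | cons γ e ih =>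
    cases δ with
    | nil => simp at hlen
    | cons δ e' =>
      simp only [ArrowPartition.pathType, Nat.add_eq_zero_iff, ite_eq_right_iff, one_ne_zero,
        imp_false] at hγ hδ
      have := ih δ hγ.1 hδ.1 (by simpa using hlen)
      obtain ⟨rfl, h2⟩ := Sigma.mk.inj_iff.1 this
      obtain rfl := eq_of_heq h2
      have htype : S.type e = S.type e' := by
        have h1 := hγ.2
        have h2 := hδ.2
        omega
      obtain ⟨rfl, h2⟩ := Sigma.mk.inj_iff.1 (S.sigma_eq_of_type_eq e e' htype)
      obtain rfl := eq_of_heq h2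
      rfl

/-- Maps along admissible paths thus depend only on the endpoints, with no scalar ambiguity. -/
theorem eq_of_admissible {a b : Q} {γ δ : Quiver.Path a b} (hγ : S.Admissible γ)
    (hδ : S.Admissible δ) : γ = δ := by
  have h := (S.end_eq_iff γ δ hγ hδ).1 rfl
  obtain ⟨i, hi⟩ := hγ
  exact eq_of_heq (Sigma.mk.inj_iff.1 (S.sigma_path_eq i γ δ hi (h ▸ hi) h)).2

/-- The target of the arrow of type `i` leaving `a`. -/
noncomputable def next (i : Fin 2) (a : Q) : Q := (S.existsUnique_arrow a i).choose.1

/-- The arrow of type `i` leaving `a`. -/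
noncomputable def arrow (i : Fin 2) (a : Q) : a ⟶ S.next i a := (S.existsUnique_arrow a i).choose.2

@[simp]
theorem type_arrow (i : Fin 2) (a : Q) : S.type (S.arrow i a) = i :=
  (S.existsUnique_arrow a i).choose_spec.1

theorem eq_next {a b : Q} (e : a ⟶ b) : b = S.next (S.type e) a :=
  congrArg Sigma.fst (S.sigma_eq_of_type_eq e (S.arrow (S.type e) a) (by simp))

/-- Two consecutive arrows of different types form a minimal circuit. -/
theorem next_next {i j : Fin 2} (h : i ≠ j) (a : Q) : S.next i (S.next j a) = a := by
  refine (S.circuit (((Quiver.Path.nil).cons (S.arrow j a)).cons (S.arrow i (S.next j a)))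
    ((S.minimalCircuit_iff _).2 ?_)).symm
  simp only [ArrowPartition.pathType, type_arrow]
  fin_cases i <;> fin_cases j <;> simp at h ⊢

/-- The permutation of the vertices along the arrows of type `1`. -/
noncomputable def shift : Equiv.Perm Q where
  toFun := S.next 1
  invFun := S.next 0
  left_inv := S.next_next (by decide)
  right_inv := S.next_next (by decide)

theorem eq_shift_zpow {a b : Q} (γ : Quiver.Path a b) :
    b = (S.shift ^ ((S.pathType γ 1 : ℤ) - S.pathType γ 0)) a := by
  induction γ with
  | nil => simp [ArrowPartition.pathType]
  | cons γ e ih =>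
    refine (S.eq_next e).trans ((congrArg (S.next (S.type e)) ih).trans ?_)
    simp only [ArrowPartition.pathType]
    rcases Fin.exists_fin_two.1 ⟨S.type e, rfl⟩ with h | h
    · rw [h]
      change S.shift⁻¹ _ = _
      rw [← Equiv.Perm.mul_apply, ← zpow_neg_one, ← zpow_add]
      congr 2
      push_cast
      simp
      ring
    · rw [h]
      change S.shift _ = _
      rw [← Equiv.Perm.mul_apply, ← zpow_one_add]
      congr 2
      push_cast
      simp
      ring

theorem exists_path (i : Fin 2) (a : Q) (r : ℕ) :
    ∃ (b : Q) (γ : Quiver.Path a b), ∀ j, S.pathType γ j = if i = j then r else 0 := by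
  induction r with
  | zero => exact ⟨a, Quiver.Path.nil, by simp [ArrowPartition.pathType]⟩
  | succ r ih =>
    obtain ⟨b, γ, h⟩ := ih
    refine ⟨_, γ.cons (S.arrow i b), fun j => ?_⟩
    simp only [ArrowPartition.pathType, h, type_arrow]
    split_ifs <;> rfl

/-- A path of `|m|` arrows of one type is admissible. If it returns to `a`, it has the type of the
trivial path. -/
theorem eq_zero_of_shift_zpow_eq {a : Q} {m : ℤ} (h : (S.shift ^ m) a = a) : m = 0 := by
  have key : ∀ {b : Q} (γ : Quiver.Path a b), S.Admissible γ →
      m = (S.pathType γ 1 : ℤ) - S.pathType γ 0 → m = 0 := by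
    intro b γ hγ hm
    have hb := S.eq_shift_zpow γ
    rw [← hm, h] at hb
    have := (S.end_eq_iff γ (Quiver.Path.nil : Quiver.Path a a) hγ ⟨0, rfl⟩).1 hb
    rw [hm, this]
    simp [ArrowPartition.pathType]
  rcases le_total 0 m with hm | hm
  · obtain ⟨b, γ, hγ⟩ := S.exists_path 1 a m.toNat
    exact key γ ⟨0, by simp [hγ]⟩ (by simp [hγ, hm])
  · obtain ⟨b, γ, hγ⟩ := S.exists_path 0 a (-m).toNat
    exact key γ ⟨1, by simp [hγ]⟩ (by simp [hγ]; omega)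

theorem exists_degree : ∃ deg : Q ≃ ℤ, ∀ {a b : Q} (γ : Quiver.Path a b),
    deg b = deg a + S.pathType γ 1 - S.pathType γ 0 := by
  -- Only a vertex is needed here, as the origin of the degree.
  obtain ⟨o, -⟩ := S.exists_arrow 0
  have hbij : Function.Bijective fun m : ℤ => (S.shift ^ m) o := by
    refine ⟨fun m m' h => ?_, fun b => ?_⟩
    · have : (S.shift ^ (m - m')) o = o := by
        rw [sub_eq_neg_add, zpow_add, Equiv.Perm.mul_apply]
        change (S.shift ^ m) o = (S.shift ^ m') o at h
        rw [h, ← Equiv.Perm.mul_apply, ← zpow_add]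
        simp
      have := S.eq_zero_of_shift_zpow_eq this
      omega
    · obtain ⟨γ, -⟩ := S.exists_admissible o b
      exact ⟨_, (S.eq_shift_zpow γ).symm⟩
  obtain ⟨e, he⟩ : ∃ e : ℤ ≃ Q, ∀ m, e m = (S.shift ^ m) o :=
    ⟨Equiv.ofBijective _ hbij, fun _ => rfl⟩
  refine ⟨e.symm, fun {a b} γ => ?_⟩
  obtain ⟨m, rfl⟩ := e.surjective a
  rw [Equiv.symm_apply_eq, Equiv.symm_apply_apply, he]
  refine (S.eq_shift_zpow γ).trans ((congrArg _ (he m)).trans ?_)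
  rw [← Equiv.Perm.mul_apply, ← zpow_add]
  congr 2
  ring

end ZStructure

end Paths

/-! ### The simple nets -/

/-- The degree of `b` is between those of `a` and `c`. -/
def Between {Q : Type u} (deg : Q ≃ ℤ) (a b c : Q) : Prop :=
  deg a ≤ deg b ∧ deg b ≤ deg c ∨ deg c ≤ deg b ∧ deg b ≤ deg a

section PrincipalNet

variable {Q : Type u} [Quiver.{w} Q] {A : Type u'} [Category.{v'} A] [Abelian A]

open Classical in
/-- The net generated at `d` by the object `Y`: the identity along the arrows that lead away from
`d`, and zero along the others. -/
noncomputable def principalNet (deg : Q ≃ ℤ) (d : Q) (Y : A) : Q ⥤q A where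
  obj _ := Y
  map {a b} _ := if Between deg d a b then 𝟙 Y else 0

theorem isIso_principalNet_map {deg : Q ≃ ℤ} {d a b : Q} (Y : A) (e : a ⟶ b)
    (h : Between deg d a b) : IsIso ((principalNet deg d Y).map e) := by
  have : (principalNet deg d Y).map e = 𝟙 Y := if_pos h
  rw [this]
  exact inferInstanceAs (IsIso (𝟙 Y))

theorem principalNet_map_eq_zero {deg : Q ≃ ℤ} {d a b : Q} (Y : A) (e : a ⟶ b)
    (h : ¬ Between deg d a b) : (principalNet deg d Y).map e = 0 := if_neg h

variable {deg : Q ≃ ℤ} {S : ZStructure Q 1}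

/-- The condition says that the path moves in one direction, away from `d`, and this can be tested
arrow by arrow. It is exactly the condition for the map of `principalNet` along the path to be an
isomorphism rather than zero when `Y` is nonzero. -/
theorem between_cons
    (hdeg : ∀ {a b : Q} (γ : Quiver.Path a b), deg b = deg a + S.pathType γ 1 - S.pathType γ 0)
    (d : Q) {a b c : Q} (γ : Quiver.Path a b) (e : b ⟶ c) :
    S.Admissible (γ.cons e) ∧ Between deg d a c ↔
      (S.Admissible γ ∧ Between deg d a b) ∧ Between deg d b c := by
  have h1 := hdeg γ
  have h2 := hdeg (γ.cons e)
  rw [S.admissible_iff, S.admissible_iff]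
  unfold Between
  simp only [ArrowPartition.pathType] at h2 ⊢
  rcases Fin.exists_fin_two.1 ⟨S.type e, rfl⟩ with h | h <;> rw [h] at h2 ⊢ <;>
    simp at h2 ⊢ <;> omega

theorem isIso_pathMap_principalNet
    (hdeg : ∀ {a b : Q} (γ : Quiver.Path a b), deg b = deg a + S.pathType γ 1 - S.pathType γ 0)
    {d : Q} (Y : A) {a b : Q} (γ : Quiver.Path a b) (hγ : S.Admissible γ)
    (h : Between deg d a b) : IsIso (pathMap (principalNet deg d Y) γ) := by
  induction γ with
  | nil => exact inferInstanceAs (IsIso (𝟙 _))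
  | cons γ e ih =>
    obtain ⟨⟨h1, h2⟩, h3⟩ := (between_cons hdeg d γ e).1 ⟨hγ, h⟩
    have := ih h1 h2
    have := isIso_principalNet_map Y e h3
    exact inferInstanceAs (IsIso (_ ≫ _))

theorem pathMap_principalNet_eq_zero
    (hdeg : ∀ {a b : Q} (γ : Quiver.Path a b), deg b = deg a + S.pathType γ 1 - S.pathType γ 0)
    {d : Q} (Y : A) {a b : Q} (γ : Quiver.Path a b)
    (h : ¬ (S.Admissible γ ∧ Between deg d a b)) : pathMap (principalNet deg d Y) γ = 0 := by
  induction γ with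
  | nil => exact absurd ⟨⟨0, rfl⟩, by unfold Between; omega⟩ h
  | cons γ e ih =>
    rw [between_cons hdeg, not_and_or] at h
    rw [pathMap]
    rcases h with h | h
    · rw [ih h, zero_comp]
    · rw [principalNet_map_eq_zero Y e h, comp_zero]

theorem kernelSubobject_eq_bot {X Y : A} (f : X ⟶ Y) [Mono f] : kernelSubobject f = ⊥ := by
  rw [eq_bot_iff, ← Subobject.mk_arrow (kernelSubobject f)]
  exact (Subobject.mk_eq_bot_iff_zero.2 (zero_of_comp_mono f (kernelSubobject_arrow_comp f))).le

theorem kernelSubobject_eq_imageSubobject {X Y : A} {f : X ⟶ Y} {g : Y ⟶ X}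
    (h : IsIso f ∧ g = 0 ∨ f = 0 ∧ IsIso g) : kernelSubobject f = imageSubobject g := by
  obtain ⟨h, rfl⟩ | ⟨rfl, h⟩ := h
  · rw [imageSubobject_zero, kernelSubobject_eq_bot]
  · rw [kernelSubobject_zero, imageSubobject_mono, Subobject.mk_eq_top_of_isIso]

theorem isLinkedNet_principalNet
    (hdeg : ∀ {a b : Q} (γ : Quiver.Path a b), deg b = deg a + S.pathType γ 1 - S.pathType γ 0)
    (k : Type*) [Field k] [Linear k A] (d : Q) (Y : A) :
    IsLinkedNet S k (principalNet deg d Y) where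
  smul {a b} γ₁ γ₂ h₂ := by
    by_cases h : S.Admissible γ₁
    · exact ⟨1, by rw [S.eq_of_admissible h h₂, one_smul]⟩
    · exact ⟨0, by rw [pathMap_principalNet_eq_zero hdeg Y γ₁ (fun h' => h h'.1), zero_smul]⟩
  circuit γ h := by
    refine pathMap_principalNet_eq_zero hdeg Y γ ?_
    rintro ⟨h', -⟩
    rw [S.minimalCircuit_iff] at h
    rw [S.admissible_iff] at h'
    omega
  ker_inf_ker {a b c} γ₁ γ₂ h₁ h₂ h := by
    -- The two paths go in opposite directions from `a`, or one is trivial, so one of them does not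
    -- approach `d`.
    have key : Between deg d a b ∨ Between deg d a c := by
      have e1 := hdeg γ₁
      have e2 := hdeg γ₂
      have i0 : S.pathType γ₁ 0 = 0 ∨ S.pathType γ₂ 0 = 0 := h 0
      have i1 : S.pathType γ₁ 1 = 0 ∨ S.pathType γ₂ 1 = 0 := h 1
      rw [S.admissible_iff] at h₁ h₂
      unfold Between
      omega
    rcases key with h | h
    · have := isIso_pathMap_principalNet hdeg Y γ₁ h₁ h
      rw [kernelSubobject_eq_bot, bot_inf_eq]
    · have := isIso_pathMap_principalNet hdeg Y γ₂ h₂ h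
      rw [kernelSubobject_eq_bot (pathMap _ γ₂), inf_bot_eq]

theorem exactNet_principalNet
    (hdeg : ∀ {a b : Q} (γ : Quiver.Path a b), deg b = deg a + S.pathType γ 1 - S.pathType γ 0)
    (d : Q) (Y : A) : ExactNet S (principalNet deg d Y) := by
  intro a b hab γ μ hγ hμ
  obtain ⟨hne, δ, hδ, hδ'⟩ := hab
  have hne' : deg a ≠ deg b := fun h => hne (deg.injective h)
  have e := hdeg δ
  rw [S.admissible_iff] at hδ
  rw [S.simplePath_iff] at hδ'
  -- Of two adjacent vertices one is strictly closer to `d`.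
  have key : (Between deg d a b ∧ ¬ Between deg d b a) ∨
      (¬ Between deg d a b ∧ Between deg d b a) := by
    unfold Between
    omega
  refine kernelSubobject_eq_imageSubobject ?_
  obtain ⟨h, h'⟩ | ⟨h, h'⟩ := key
  · exact Or.inl ⟨isIso_pathMap_principalNet hdeg Y γ hγ h,
      pathMap_principalNet_eq_zero hdeg Y μ fun h => h' h.2⟩
  · exact Or.inr ⟨pathMap_principalNet_eq_zero hdeg Y γ fun h' => h h'.2,
      isIso_pathMap_principalNet hdeg Y μ hμ h'⟩

theorem locallyFiniteNet_principalNet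
    (hdeg : ∀ {a b : Q} (γ : Quiver.Path a b), deg b = deg a + S.pathType γ 1 - S.pathType γ 0)
    (d : Q) (Y : A) : LocallyFiniteNet (principalNet deg d Y) := by
  intro b
  -- A path with nonzero map to `b` starts between `d` and `b`, which bounds its length.
  refine ⟨(deg b - deg d).natAbs, fun a γ hγ => pathMap_principalNet_eq_zero hdeg Y γ ?_⟩
  rintro ⟨h, h'⟩
  have e := hdeg γ
  rw [S.admissible_iff] at h
  rw [S.length_eq] at hγ
  unfold Between at h'
  omega

end PrincipalNet

/-! ### Families of objects and maps indexed by the integers -/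

section ExactSystem

variable {Q : Type u} {A : Type u'} [Category.{v'} A] [Abelian A]

/-- The maps along the admissible paths of a locally finite exact linked net over a `ℤ¹`-quiver,
in terms of generalized elements. -/
structure IsExactSystem (deg : Q ≃ ℤ) {V : Q → A} (p : ∀ a b, V a ⟶ V b) : Prop where
  map_self : ∀ a, p a a = 𝟙 (V a)
  comp_eq : ∀ {a b c}, Between deg a b c → p a b ≫ p b c = p a c
  comp_eq_zero : ∀ {a b c}, ¬ Between deg a b c → p a b ≫ p b c = 0
  exact : ∀ {a b}, deg b = deg a + 1 ∨ deg b = deg a - 1 → ∀ {T : A} (x : T ⟶ V a),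
    x ≫ p a b = 0 → ∃ y, y ≫ p b a = x
  eq_zero : ∀ {a b c}, Between deg b a c → ∀ {T : A} (x : T ⟶ V a),
    x ≫ p a b = 0 → x ≫ p a c = 0 → x = 0
  finite : ∀ b, ∃ l : ℕ, ∀ a, l < (deg a - deg b).natAbs → p a b = 0

variable {deg : Q ≃ ℤ} {V : Q → A} {p : ∀ a b, V a ⟶ V b}

theorem exists_degree_eq (deg : Q ≃ ℤ) (m : ℤ) : ∃ a, deg a = m := deg.surjective m

/-- The image of `x` at `k` dies both on returning to `j` and on continuing to `i`, and these two
kernels meet trivially. -/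
theorem IsExactSystem.comp_eq_zero_of_adjacent (h : IsExactSystem deg p) {j k i : Q}
    (hk : deg k = deg j + 1 ∨ deg k = deg j - 1) (hb : Between deg j k i) {T : A} (x : T ⟶ V j)
    (hx : x ≫ p j i = 0) : x ≫ p j k = 0 := by
  refine h.eq_zero hb (x ≫ p j k) ?_ ?_
  · rw [Category.assoc, h.comp_eq_zero (by unfold Between; omega), comp_zero]
  · rw [Category.assoc, h.comp_eq hb, hx]

/-! ### Independent and generating families of summands -/

section Family

variable {ι : Type*} [Fintype ι] {Y : ι → A} {d : ι → Q}

/-- The map to `V a` from the direct sum of the objects `Y t`, each placed at `d t`. -/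
noncomputable def sumMap (p : ∀ a b, V a ⟶ V b) (s : ∀ t, Y t ⟶ V (d t)) (a : Q) : ⨁ Y ⟶ V a :=
  biproduct.desc fun t => s t ≫ p (d t) a

open Classical in
/-- The projection of a direct sum to the sum of the summands with a given property. -/
noncomputable def restrict (Y : ι → A) (P : ι → Prop) : ⨁ Y ⟶ ⨁ Y :=
  biproduct.map fun t => if P t then 𝟙 (Y t) else 0

theorem restrict_π_of_pos {P : ι → Prop} {t : ι} (h : P t) :
    restrict Y P ≫ biproduct.π Y t = biproduct.π Y t := by
  simp [restrict, h]

theorem restrict_π_of_neg {P : ι → Prop} {t : ι} (h : ¬ P t) :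
    restrict Y P ≫ biproduct.π Y t = 0 := by
  simp [restrict, h]

variable {s : ∀ t, Y t ⟶ V (d t)}

theorem comp_sumMap {T : A} (c : T ⟶ ⨁ Y) (a : Q) :
    c ≫ sumMap p s a = ∑ t, (c ≫ biproduct.π Y t) ≫ s t ≫ p (d t) a := by
  have : sumMap p s a = ∑ t, biproduct.π Y t ≫ s t ≫ p (d t) a := by
    refine biproduct.hom_ext' _ _ fun t => ?_
    rw [sumMap, biproduct.ι_desc, Preadditive.comp_sum, Finset.sum_eq_single t]
    · rw [biproduct.ι_π_self_assoc]
    · intro t' _ ht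
      rw [biproduct.ι_π_ne_assoc _ ht.symm, zero_comp]
    · simp
  rw [this, Preadditive.comp_sum]
  simp only [Category.assoc]

/-- Going from `a` to `b` keeps the summands for which this leads away from `d t` and kills the
others. -/
theorem IsExactSystem.sumMap_comp (h : IsExactSystem deg p) {T : A} (c : T ⟶ ⨁ Y) (a b : Q) :
    (c ≫ sumMap p s a) ≫ p a b =
      (c ≫ restrict Y fun t => Between deg (d t) a b) ≫ sumMap p s b := by
  rw [comp_sumMap, comp_sumMap, Preadditive.sum_comp]
  refine Finset.sum_congr rfl fun t _ => ?_
  simp only [Category.assoc]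
  by_cases ht : Between deg (d t) a b
  · have e := restrict_π_of_pos (Y := Y) (P := fun t => Between deg (d t) a b) ht
    rw [reassoc_of% e, h.comp_eq ht]
  · have e := restrict_π_of_neg (Y := Y) (P := fun t => Between deg (d t) a b) ht
    rw [reassoc_of% e, h.comp_eq_zero ht]
    simp

theorem comp_restrict_eq_self {T : A} {c : T ⟶ ⨁ Y} {P : ι → Prop}
    (hc : ∀ t, c ≫ biproduct.π Y t ≠ 0 → P t) : c ≫ restrict Y P = c := by
  refine biproduct.hom_ext _ _ fun t => ?_
  rw [Category.assoc]
  by_cases ht : P t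
  · rw [restrict_π_of_pos ht]
  · rw [restrict_π_of_neg ht, comp_zero]
    by_contra hne
    exact ht (hc t (Ne.symm hne))

theorem comp_restrict_eq_zero {T : A} {c : T ⟶ ⨁ Y} {P : ι → Prop}
    (hc : ∀ t, c ≫ biproduct.π Y t ≠ 0 → ¬ P t) : c ≫ restrict Y P = 0 := by
  refine biproduct.hom_ext _ _ fun t => ?_
  rw [Category.assoc, zero_comp]
  by_cases ht : P t
  · rw [restrict_π_of_pos ht]
    by_contra hne
    exact hc t hne ht
  · rw [restrict_π_of_neg ht, comp_zero]

/-- The summands placed at `a` are independent modulo the images of the neighbors of `a`. -/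
def Independent (deg : Q ≃ ℤ) (p : ∀ a b, V a ⟶ V b) (s : ∀ t, Y t ⟶ V (d t)) : Prop :=
  ∀ {a u v : Q}, deg u = deg a - 1 → deg v = deg a + 1 → ∀ {T : A} (c : T ⟶ ⨁ Y) (y : T ⟶ V u)
    (z : T ⟶ V v), c ≫ sumMap p s a = y ≫ p u a + z ≫ p v a →
      ∀ t, d t = a → c ≫ biproduct.π Y t = 0

/-- The summands placed at `a` generate modulo the images of the neighbors of `a`. -/
def Generating (deg : Q ≃ ℤ) (p : ∀ a b, V a ⟶ V b) (s : ∀ t, Y t ⟶ V (d t)) : Prop :=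
  ∀ {a u v : Q}, deg u = deg a - 1 → deg v = deg a + 1 → ∀ {T : A} (x : T ⟶ V a),
    ∃ (c : T ⟶ ⨁ Y) (y : T ⟶ V u) (z : T ⟶ V v), x = c ≫ sumMap p s a + y ≫ p u a + z ≫ p v a

theorem Independent.eq_zero_of_image (hs : Independent deg p s) {a b : Q}
    (hb : deg b = deg a + 1 ∨ deg b = deg a - 1) {T : A} (c : T ⟶ ⨁ Y) (y : T ⟶ V b)
    (hc : c ≫ sumMap p s a = y ≫ p b a) (t : ι) (ht : d t = a) : c ≫ biproduct.π Y t = 0 := by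
  rcases hb with hb | hb
  · obtain ⟨u, hu⟩ := exists_degree_eq deg (deg a - 1)
    exact hs hu hb c 0 y (by simpa using hc) t ht
  · obtain ⟨u, hu⟩ := exists_degree_eq deg (deg a + 1)
    exact hs hb hu c y 0 (by simpa using hc) t ht

/-- The sign `ε` records the side: `1` for summands placed below `i`, `-1` for those above.
Induction on `r` removes the summands at distance `r + 1`, nearest first. -/
theorem Independent.eq_zero_of_oneSided (hs : Independent deg p s) (h : IsExactSystem deg p)
    {ε : ℤ} (hε : ε = 1 ∨ ε = -1) {i : Q} {T : A} (c : T ⟶ ⨁ Y)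
    (hsupp : ∀ t, c ≫ biproduct.π Y t ≠ 0 → 0 < ε * (deg i - deg (d t)))
    (hc : c ≫ sumMap p s i = 0) : c = 0 := by
  have key : ∀ r : ℕ, ∀ t, c ≫ biproduct.π Y t ≠ 0 → (r : ℤ) < ε * (deg i - deg (d t)) := by
    intro r
    induction r with
    | zero => exact_mod_cast hsupp
    | succ r ih =>
      intro t ht
      by_contra hlt
      have ht' := ih t ht
      obtain ⟨k, hk⟩ := exists_degree_eq deg (deg (d t) + ε)
      have hk' : deg k = deg (d t) + 1 ∨ deg k = deg (d t) - 1 := by omega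
      -- All remaining summands lie at `d t` or beyond it, so none is lost from `d t` to `i`. Hence
      -- the sum at `d t` dies at `i`, so already at the adjacent `k`; by exactness it comes from
      -- `k`, contrary to independence.
      have hx : (c ≫ sumMap p s (d t)) ≫ p (d t) i = 0 := by
        rw [h.sumMap_comp, comp_restrict_eq_self, hc]
        intro t' h'
        have := ih t' h'
        unfold Between
        rcases hε with rfl | rfl <;> push_cast at * <;> omega
      have hx' := h.comp_eq_zero_of_adjacent hk'
        (by unfold Between; rcases hε with rfl | rfl <;> push_cast at * <;> omega) _ hx
      obtain ⟨y, hy⟩ := h.exact hk' _ hx'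
      exact ht (hs.eq_zero_of_image hk' c y hy.symm t rfl)
  refine biproduct.hom_ext _ _ fun t => ?_
  rw [zero_comp]
  by_contra hne
  have := key (ε * (deg i - deg (d t))).toNat t hne
  omega

/-- Summands placed at `i` drop out by independence, which leaves `c₁` from below and `c₂` from
above, each to be treated by `eq_zero_of_oneSided`. -/
theorem Independent.mono_sumMap (hs : Independent deg p s) (h : IsExactSystem deg p) (i : Q) :
    Mono (sumMap p s i) := by
  refine Preadditive.mono_of_cancel_zero _ fun {T} c hc => ?_
  obtain ⟨u, hu⟩ := exists_degree_eq deg (deg i - 1)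
  obtain ⟨v, hv⟩ := exists_degree_eq deg (deg i + 1)
  have h0 : ∀ t, d t = i → c ≫ biproduct.π Y t = 0 := hs hu hv c 0 0 (by simpa using hc)
  set c₁ := c ≫ restrict Y fun t => deg (d t) < deg i with hc₁
  set c₂ := c ≫ restrict Y fun t => deg i < deg (d t) with hc₂
  have hs₁ : ∀ t, c₁ ≫ biproduct.π Y t ≠ 0 → deg (d t) < deg i := by
    intro t ht
    by_contra hlt
    rw [hc₁, Category.assoc,
      restrict_π_of_neg (P := fun t => deg (d t) < deg i) hlt, comp_zero] at ht
    exact ht rfl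
  have hs₂ : ∀ t, c₂ ≫ biproduct.π Y t ≠ 0 → deg i < deg (d t) := by
    intro t ht
    by_contra hlt
    rw [hc₂, Category.assoc,
      restrict_π_of_neg (P := fun t => deg i < deg (d t)) hlt, comp_zero] at ht
    exact ht rfl
  have hadd : c = c₁ + c₂ := by
    refine biproduct.hom_ext _ _ fun t => ?_
    rw [Preadditive.add_comp, hc₁, hc₂, Category.assoc, Category.assoc]
    rcases lt_trichotomy (deg (d t)) (deg i) with hlt | heq | hlt
    · rw [restrict_π_of_pos (P := fun t => deg (d t) < deg i) hlt,
        restrict_π_of_neg (P := fun t => deg i < deg (d t)) hlt.not_gt, comp_zero, add_zero]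
    · rw [restrict_π_of_neg (P := fun t => deg (d t) < deg i) heq.not_lt,
        restrict_π_of_neg (P := fun t => deg i < deg (d t)) heq.not_gt, comp_zero, add_zero,
        h0 t (deg.injective heq)]
    · rw [restrict_π_of_pos (P := fun t => deg i < deg (d t)) hlt,
        restrict_π_of_neg (P := fun t => deg (d t) < deg i) hlt.not_gt, comp_zero, zero_add]
  rw [hadd, Preadditive.add_comp] at hc
  have hneg : c₁ ≫ sumMap p s i = -(c₂ ≫ sumMap p s i) := eq_neg_of_add_eq_zero_left hc
  -- The contribution from below dies going down. Being minus the contribution from above, it also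
  -- dies going up.
  have hzero : c₁ ≫ sumMap p s i = 0 := by
    refine h.eq_zero (b := v) (c := u) (by unfold Between; omega) _ ?_ ?_
    · rw [hneg, Preadditive.neg_comp, h.sumMap_comp, comp_restrict_eq_zero, zero_comp, neg_zero]
      intro t ht
      have := hs₂ t ht
      unfold Between
      omega
    · rw [h.sumMap_comp, comp_restrict_eq_zero, zero_comp]
      intro t ht
      have := hs₁ t ht
      unfold Between
      omega
  have e₁ : c₁ = 0 := hs.eq_zero_of_oneSided h (Or.inl rfl) c₁
    (fun t ht => by have := hs₁ t ht; omega) hzero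
  have e₂ : c₂ = 0 := hs.eq_zero_of_oneSided h (Or.inr rfl) (i := i) c₂
    (fun t ht => by have := hs₂ t ht; omega) (by simpa [hzero] using hneg.symm)
  rw [hadd, e₁, e₂, add_zero]

/-- Decompose the remainder `y'` at `j'`: its part from the neighbor nearer to `i` dies on going
back towards `i`, so only a remainder from one vertex farther away survives. -/
theorem Generating.exists_of_adjacent (hs : Generating deg p s) (h : IsExactSystem deg p)
    {ε : ℤ} (hε : ε = 1 ∨ ε = -1) {i j : Q} (hj : deg i - deg j = ε) {T : A} (y : T ⟶ V j) :
    ∃ c : T ⟶ ⨁ Y, c ≫ sumMap p s i = y ≫ p j i := by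
  have key : ∀ r : ℕ, ∃ (c : T ⟶ ⨁ Y) (j' : Q) (y' : T ⟶ V j'), deg i - deg j' = ε * (r + 1) ∧
      y ≫ p j i = c ≫ sumMap p s i + y' ≫ p j' i := by
    intro r
    induction r with
    | zero => exact ⟨0, j, y, by simpa using hj, by simp⟩
    | succ r ih =>
      obtain ⟨c, j', y', hj', hy'⟩ := ih
      obtain ⟨u, hu⟩ := exists_degree_eq deg (deg j' - 1)
      obtain ⟨v, hv⟩ := exists_degree_eq deg (deg j' + 1)
      obtain ⟨c', y'', z, hx⟩ := hs hu hv y'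
      rw [hx, Preadditive.add_comp, Preadditive.add_comp, h.sumMap_comp] at hy'
      rcases hε with rfl | rfl
      · refine ⟨c + c' ≫ restrict Y fun t => Between deg (d t) j' i, u, y'',
          by push_cast; omega, ?_⟩
        rw [hy', Category.assoc z, h.comp_eq_zero (a := v) (by unfold Between; omega), comp_zero,
          Category.assoc y'', h.comp_eq (by unfold Between; omega), Preadditive.add_comp]
        abel
      · refine ⟨c + c' ≫ restrict Y fun t => Between deg (d t) j' i, v, z,
          by push_cast; omega, ?_⟩
        rw [hy', Category.assoc y'', h.comp_eq_zero (a := u) (by unfold Between; omega), comp_zero,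
          Category.assoc z, h.comp_eq (by unfold Between; omega), Preadditive.add_comp]
        abel
  obtain ⟨l, hl⟩ := h.finite i
  -- The remainder now sits at distance `l + 1`, just beyond the bound.
  obtain ⟨c, j', y', hj', hy'⟩ := key l
  refine ⟨c, ?_⟩
  rw [hy', hl j' (by rcases hε with rfl | rfl <;> omega), comp_zero, add_zero]

theorem Generating.epi_sumMap (hs : Generating deg p s) (h : IsExactSystem deg p) (i : Q) :
    Epi (sumMap p s i) := by
  obtain ⟨u, hu⟩ := exists_degree_eq deg (deg i - 1)
  obtain ⟨v, hv⟩ := exists_degree_eq deg (deg i + 1)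
  obtain ⟨c, y, z, hx⟩ := hs hu hv (𝟙 (V i))
  obtain ⟨c₁, h₁⟩ := hs.exists_of_adjacent h (i := i) (Or.inl rfl) (by omega) y
  obtain ⟨c₂, h₂⟩ := hs.exists_of_adjacent h (i := i) (Or.inr rfl) (by omega) z
  have : SplitEpi (sumMap p s i) := ⟨c + c₁ + c₂, by
    rw [Preadditive.add_comp, Preadditive.add_comp, h₁, h₂, ← hx]⟩
  exact this.epi

end Family

end ExactSystem

/-! ### Complements to the images of the neighbors, and the decomposition -/

section Decomposition

variable {Q : Type u} {A : Type u'} [Category.{v'} A] [Abelian A]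
variable {deg : Q ≃ ℤ} {V : Q → A} {p : ∀ a b, V a ⟶ V b}

/-- A complement at `a` to the sum of the images of the neighbors of `a`. -/
structure NeighborComplement (deg : Q ≃ ℤ) (p : ∀ a b, V a ⟶ V b) (a : Q) where
  X : A
  π : V a ⟶ X
  s : X ⟶ V a
  s_π : s ≫ π = 𝟙 X
  map_π : ∀ b, b ≠ a → p b a ≫ π = 0
  exists_of_comp_eq_zero : ∀ {u v : Q}, deg u = deg a - 1 → deg v = deg a + 1 → ∀ {T : A}
    (x : T ⟶ V a), x ≫ π = 0 → ∃ (y : T ⟶ V u) (z : T ⟶ V v), x = y ≫ p u a + z ≫ p v a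

theorem IsExactSystem.exists_neighborComplement (h : IsExactSystem deg p)
    (hA : ∀ X : A, Projective X) (a : Q) : Nonempty (NeighborComplement deg p a) := by
  obtain ⟨u, hu⟩ := exists_degree_eq deg (deg a - 1)
  obtain ⟨v, hv⟩ := exists_degree_eq deg (deg a + 1)
  let f := biprod.desc (p u a) (p v a)
  have hπu : p u a ≫ cokernel.π f = 0 := by
    have : biprod.inl ≫ f = p u a := biprod.inl_desc _ _
    rw [← this, Category.assoc, cokernel.condition, comp_zero]
  have hπv : p v a ≫ cokernel.π f = 0 := by
    have : biprod.inr ≫ f = p v a := biprod.inr_desc _ _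
    rw [← this, Category.assoc, cokernel.condition, comp_zero]
  obtain ⟨s, hs⟩ := (hA (cokernel f)).factors (𝟙 _) (cokernel.π f)
  refine ⟨cokernel f, cokernel.π f, s, hs, fun b hb => ?_, fun {u' v'} hu' hv' {T} x hx => ?_⟩
  -- A map from any other vertex factors through the adjacent vertex on its side.
  · have hb' : deg b ≠ deg a := fun e => hb (deg.injective e)
    rcases lt_or_gt_of_ne hb' with hlt | hlt
    · rw [← h.comp_eq (a := b) (b := u) (c := a) (by unfold Between; omega), Category.assoc, hπu,
        comp_zero]
    · rw [← h.comp_eq (a := b) (b := v) (c := a) (by unfold Between; omega), Category.assoc, hπv,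
        comp_zero]
  · obtain rfl : u' = u := deg.injective (by omega)
    obtain rfl : v' = v := deg.injective (by omega)
    have := hA T
    have hex := ShortComplex.exact_cokernel f
    let y := hex.liftFromProjective x hx
    have hy : y ≫ f = x := hex.liftFromProjective_comp x hx
    refine ⟨y ≫ biprod.fst, y ≫ biprod.snd, ?_⟩
    rw [← hy]
    simp [f, biprod.desc_eq]

/-- The section dies at `o`, hence at the adjacent vertex towards `o`, so by exactness it factors
through that vertex's image, which `π` kills. -/
theorem NeighborComplement.isZero (h : IsExactSystem deg p) {a o : Q}
    (C : NeighborComplement deg p a) (hne : o ≠ a) (hz : p a o = 0) : IsZero C.X := by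
  have hne' : deg o ≠ deg a := fun e => hne (deg.injective e)
  obtain ⟨k, hk, hb⟩ : ∃ k, (deg k = deg a + 1 ∨ deg k = deg a - 1) ∧ Between deg a k o := by
    rcases lt_or_gt_of_ne hne' with hlt | hlt
    · obtain ⟨k, hk⟩ := exists_degree_eq deg (deg a - 1)
      exact ⟨k, Or.inr hk, by unfold Between; omega⟩
    · obtain ⟨k, hk⟩ := exists_degree_eq deg (deg a + 1)
      exact ⟨k, Or.inl hk, by unfold Between; omega⟩
  have hs := h.comp_eq_zero_of_adjacent hk hb C.s (by rw [hz, comp_zero])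
  obtain ⟨y, hy⟩ := h.exact hk C.s hs
  have hka : k ≠ a := by
    rintro rfl
    omega
  rw [IsZero.iff_id_eq_zero, ← C.s_π, ← hy, Category.assoc, C.map_π k hka, comp_zero]

/-- An exact system in a semisimple category is a direct sum of systems generated by simple
objects. -/
theorem IsExactSystem.exists_isIso_sumMap (h : IsExactSystem deg p)
    (hA : SemisimpleCategory A) :
    ∃ (ι : Type u) (_ : Fintype ι) (Y : ι → A) (d : ι → Q) (s : ∀ t, Y t ⟶ V (d t)),
      (∀ t, Simple (Y t)) ∧ ∀ a, IsIso (sumMap p s a) := by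
  have C : ∀ a, NeighborComplement deg p a :=
    fun a => (h.exists_neighborComplement hA.projective a).some
  choose m X hX φ' using fun a => hA (C a).X
  have φ : ∀ a, (C a).X ≅ ⨁ X a := fun a => (φ' a).some
  obtain ⟨o, ho⟩ := exists_degree_eq deg 0
  obtain ⟨l, hl⟩ := h.finite o
  -- Since `o` has degree `0`, complements outside this window vanish by
  -- `NeighborComplement.isZero`.
  have hfin : Finite {q : Q // (deg q).natAbs ≤ l} := by
    refine Finite.of_injective
      (fun q => (⟨deg q.1, by have := q.2; rw [Set.mem_Icc]; omega⟩ : Set.Icc (-(l : ℤ)) l)) ?_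
    intro q q' e
    exact Subtype.ext (deg.injective (congrArg Subtype.val e))
  let ι := Σ q : {q : Q // (deg q).natAbs ≤ l}, Fin (m q.1)
  have := Fintype.ofFinite {q : Q // (deg q).natAbs ≤ l}
  let Y : ι → A := fun t => X t.1.1 t.2
  let d : ι → Q := fun t => t.1.1
  let s : ∀ t, Y t ⟶ V (d t) := fun t => biproduct.ι (X t.1.1) t.2 ≫ (φ t.1.1).inv ≫ (C t.1.1).s
  have hind : Independent deg p s := by
    intro a u v hu hv T c y z hc t ht
    obtain ⟨⟨q, hq⟩, r⟩ := t
    obtain rfl : q = a := ht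
    have hua : u ≠ q := by rintro rfl; omega
    have hva : v ≠ q := by rintro rfl; omega
    have h1 : (c ≫ sumMap p s q) ≫ (C q).π = 0 := by
      rw [hc, Preadditive.add_comp, Category.assoc, Category.assoc, (C q).map_π u hua,
        (C q).map_π v hva, comp_zero, comp_zero, add_zero]
    -- Projecting to the complement at `q` kills the summands placed elsewhere, so it recovers the
    -- coordinates at `q`.
    have h2 : sumMap p s q ≫ (C q).π ≫ (φ q).hom ≫ biproduct.π (X q) r =
        biproduct.π Y ⟨⟨q, hq⟩, r⟩ := by
      refine biproduct.hom_ext' _ _ fun t => ?_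
      rw [sumMap, biproduct.ι_desc_assoc, Category.assoc]
      by_cases htq : d t = q
      · obtain ⟨⟨q', hq'⟩, r'⟩ := t
        obtain rfl : q' = q := htq
        change (biproduct.ι (X q') r' ≫ (φ q').inv ≫ (C q').s) ≫ p q' q' ≫ _ = _
        rw [h.map_self, Category.id_comp, Category.assoc, Category.assoc,
          reassoc_of% (C q').s_π, Iso.inv_hom_id_assoc]
        by_cases hr : r' = r
        · subst hr
          rw [biproduct.ι_π_self, biproduct.ι_π_self]
        · rw [biproduct.ι_π_ne _ hr, biproduct.ι_π_ne]
          intro he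
          cases he
          exact hr rfl
      · rw [← Category.assoc (p (d t) q), (C q).map_π _ htq, zero_comp, comp_zero, biproduct.ι_π_ne]
        rintro rfl
        exact htq rfl
    rw [← h2, ← Category.assoc, ← Category.assoc, h1, zero_comp]
  have hgen : Generating deg p s := by
    intro a u v hu hv T x
    obtain ⟨y, z, hyz⟩ := (C a).exists_of_comp_eq_zero hu hv (x - (x ≫ (C a).π) ≫ (C a).s) (by
      rw [Preadditive.sub_comp, Category.assoc, (C a).s_π, Category.comp_id, sub_self])
    have hx : x = (x ≫ (C a).π) ≫ (C a).s + y ≫ p u a + z ≫ p v a := by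
      rw [add_assoc, ← hyz]
      abel
    suffices ∃ c : T ⟶ ⨁ Y, c ≫ sumMap p s a = (x ≫ (C a).π) ≫ (C a).s by
      obtain ⟨c, hc⟩ := this
      exact ⟨c, y, z, by rw [hc, ← hx]⟩
    by_cases ha : (deg a).natAbs ≤ l
    · refine ⟨(x ≫ (C a).π) ≫ (φ a).hom ≫
        biproduct.desc fun r => biproduct.ι Y (⟨⟨a, ha⟩, r⟩ : ι), ?_⟩
      have : (biproduct.desc fun r => biproduct.ι Y (⟨⟨a, ha⟩, r⟩ : ι)) ≫ sumMap p s a =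
          (φ a).inv ≫ (C a).s := by
        refine biproduct.hom_ext' _ _ fun r => ?_
        rw [biproduct.ι_desc_assoc, sumMap, biproduct.ι_desc]
        change (biproduct.ι (X a) r ≫ (φ a).inv ≫ (C a).s) ≫ p a a = _
        rw [h.map_self, Category.comp_id]
      rw [Category.assoc _ _ (sumMap p s a), Category.assoc _ _ (sumMap p s a), this,
        Iso.hom_inv_id_assoc]
    · have hoa : o ≠ a := by rintro rfl; omega
      have hz := (C a).isZero h hoa (hl a (by omega))
      exact ⟨0, by rw [hz.eq_of_tgt (x ≫ (C a).π) 0, zero_comp, zero_comp]⟩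
  refine ⟨ι, inferInstance, Y, d, s, fun t => hX _ _, fun a => ?_⟩
  have := hind.mono_sumMap h a
  have := hgen.epi_sumMap h a
  exact isIso_of_mono_of_epi _

end Decomposition

/-! ### From nets to exact systems, and back -/

section Net

variable {Q : Type u} [Quiver.{w} Q] {A : Type u'} [Category.{v'} A]
variable (S : ZStructure Q 1)

/-- The map along an admissible path. -/
noncomputable def admissibleMap (V : Q ⥤q A) (a b : Q) : V.obj a ⟶ V.obj b :=
  pathMap V (S.exists_admissible a b).choose

variable {S}

theorem pathMap_eq_admissibleMap (V : Q ⥤q A) {a b : Q} (γ : Quiver.Path a b)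
    (hγ : S.Admissible γ) : pathMap V γ = admissibleMap S V a b := by
  rw [admissibleMap, S.eq_of_admissible hγ (S.exists_admissible a b).choose_spec]

theorem map_eq_admissibleMap (V : Q ⥤q A) {a b : Q} (e : a ⟶ b) :
    V.map e = admissibleMap S V a b := by
  rw [← pathMap_eq_admissibleMap V e.toPath]
  · exact (Category.id_comp _).symm
  · rw [S.admissible_iff]
    simp only [Quiver.Hom.toPath, ArrowPartition.pathType]
    rcases Fin.exists_fin_two.1 ⟨S.type e, rfl⟩ with h | h <;> rw [h] <;> simp

variable [Abelian A]

theorem isExactSystem_admissibleMap {deg : Q ≃ ℤ}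
    (hdeg : ∀ {a b : Q} (γ : Quiver.Path a b), deg b = deg a + S.pathType γ 1 - S.pathType γ 0)
    (hA : SemisimpleCategory A) {k : Type*} [Field k] [Linear k A] {V : Q ⥤q A}
    (hV : IsLinkedNet S k V) (hexact : ExactNet S V) (hfin : LocallyFiniteNet V) :
    IsExactSystem deg (admissibleMap S V) := by
  have hcomp : ∀ {a b c}, Between deg a b c →
      admissibleMap S V a b ≫ admissibleMap S V b c = admissibleMap S V a c := by
    intro a b c hb
    obtain ⟨γ, hγ⟩ := S.exists_admissible a b
    obtain ⟨δ, hδ⟩ := S.exists_admissible b c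
    rw [← pathMap_eq_admissibleMap V γ hγ, ← pathMap_eq_admissibleMap V δ hδ, ← pathMap_comp]
    apply pathMap_eq_admissibleMap
    have e1 := hdeg γ
    have e2 := hdeg δ
    rw [S.admissible_iff] at hγ hδ ⊢
    rw [S.pathType_comp, S.pathType_comp]
    unfold Between at hb
    omega
  have hcirc : ∀ {a b}, deg b = deg a + 1 ∨ deg b = deg a - 1 →
      admissibleMap S V a b ≫ admissibleMap S V b a = 0 := by
    intro a b hb
    obtain ⟨γ, hγ⟩ := S.exists_admissible a b
    obtain ⟨δ, hδ⟩ := S.exists_admissible b a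
    rw [← pathMap_eq_admissibleMap V γ hγ, ← pathMap_eq_admissibleMap V δ hδ, ← pathMap_comp]
    apply hV.circuit
    have e1 := hdeg γ
    have e2 := hdeg δ
    rw [S.admissible_iff] at hγ hδ
    rw [S.minimalCircuit_iff, S.pathType_comp, S.pathType_comp]
    omega
  refine ⟨fun a => ?_, hcomp, fun {a b c} hb => ?_, fun {a b} hb T x hx => ?_,
    fun {a b c} hb T x h₁ h₂ => ?_, fun b => ?_⟩
  · exact (pathMap_eq_admissibleMap V (Quiver.Path.nil : Quiver.Path a a) ⟨0, rfl⟩).symm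
  -- Here `a` and `c` lie strictly on the same side of `b`, so both maps pass through the adjacent
  -- vertex `b'` on that side, and the composite contains the circuit `b'`, `b`, `b'`.
  · obtain ⟨b', hb', h1, h2⟩ : ∃ b', (deg b' = deg b + 1 ∨ deg b' = deg b - 1) ∧
        Between deg a b' b ∧ Between deg b b' c := by
      unfold Between at *
      by_cases hlt : deg a < deg b
      · obtain ⟨b', h⟩ := exists_degree_eq deg (deg b - 1)
        exact ⟨b', by omega⟩
      · obtain ⟨b', h⟩ := exists_degree_eq deg (deg b + 1)
        exact ⟨b', by omega⟩
    rw [← hcomp h1, ← hcomp h2, Category.assoc, ← Category.assoc _ _ (admissibleMap S V b' c),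
      hcirc (by omega), zero_comp, comp_zero]
  · have := hA.projective T
    obtain ⟨γ, hγ⟩ := S.exists_admissible a b
    obtain ⟨δ, hδ⟩ := S.exists_admissible b a
    rw [← pathMap_eq_admissibleMap V γ hγ] at hx
    rw [← pathMap_eq_admissibleMap V δ hδ]
    refine exists_lift_of_kernel_eq_image (hexact ⟨?_, γ, hγ, ?_⟩ γ δ hγ hδ) x hx
    · rintro rfl
      omega
    · have e1 := hdeg γ
      rw [S.admissible_iff] at hγ
      rw [S.simplePath_iff]
      omega
  · obtain ⟨γ, hγ⟩ := S.exists_admissible a b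
    obtain ⟨δ, hδ⟩ := S.exists_admissible a c
    rw [← pathMap_eq_admissibleMap V γ hγ] at h₁
    rw [← pathMap_eq_admissibleMap V δ hδ] at h₂
    refine eq_zero_of_kernel_inf_kernel (hV.ker_inf_ker γ δ hγ hδ ?_) x h₁ h₂
    have e1 := hdeg γ
    have e2 := hdeg δ
    rw [S.admissible_iff] at hγ hδ
    unfold Between at hb
    exact Fin.forall_fin_two.2 ⟨by omega, by omega⟩
  · obtain ⟨l, hl⟩ := hfin b
    refine ⟨l, fun a ha => ?_⟩
    obtain ⟨γ, hγ⟩ := S.exists_admissible a b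
    rw [← pathMap_eq_admissibleMap V γ hγ]
    apply hl
    have e1 := hdeg γ
    rw [S.length_eq]
    omega

theorem exists_repIso_directSum (hA : SemisimpleCategory A) (S : ZStructure Q 1) {k : Type*}
    [Field k] [Linear k A] (V : Q ⥤q A) (hV : IsLinkedNet S k V) (hexact : ExactNet S V)
    (hfin : LocallyFiniteNet V) :
    ∃ (m : ℕ) (W : Fin m → (Q ⥤q A)),
      (∀ i, IsLinkedNet S k (W i) ∧ ExactNet S (W i) ∧ LocallyFiniteNet (W i) ∧ SimpleNet (W i)) ∧
      Nonempty (RepIso V (directSum W)) := by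
  obtain ⟨deg, hdeg⟩ := S.exists_degree
  have h := isExactSystem_admissibleMap hdeg hA hV hexact hfin
  obtain ⟨ι, _, Y, d, s, hY, hiso⟩ := h.exists_isIso_sumMap hA
  let e : Fin (Fintype.card ι) ≃ ι := (Fintype.equivFin ι).symm
  let W : Fin (Fintype.card ι) → (Q ⥤q A) := fun i => principalNet deg (d (e i)) (Y (e i))
  let Φ : ∀ a, (⨁ fun i => (W i).obj a) ≅ V.obj a := fun a =>
    biproduct.whiskerEquiv (f := fun i => Y (e i)) (g := Y) e (fun _ => Iso.refl _) ≪≫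
      @asIso _ _ _ _ (sumMap (admissibleMap S V) s a) (hiso a)
  have hΦ : ∀ a i, biproduct.ι (fun i => (W i).obj a) i ≫ (Φ a).hom =
      s (e i) ≫ admissibleMap S V (d (e i)) a := by
    intro a i
    change biproduct.ι (fun i => Y (e i)) i ≫ (biproduct.whiskerEquiv _ _).hom ≫
      biproduct.desc _ = _
    rw [biproduct.whiskerEquiv, biproduct.ι_desc_assoc, Category.assoc, biproduct.ι_desc]
    exact Category.id_comp _
  have hcomm : ∀ {a b : Q} (f : a ⟶ b),
      biproduct.map (fun i => (W i).map f) ≫ (Φ b).hom = (Φ a).hom ≫ V.map f := by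
    intro a b f
    refine biproduct.hom_ext' _ _ fun i => ?_
    rw [reassoc_of% hΦ a i, map_eq_admissibleMap (S := S)]
    rw [biproduct.ι_map_assoc, hΦ]
    refine Eq.trans ?_ (Category.assoc _ _ _).symm
    -- The dichotomy defining `principalNet` is the composition rule of the exact system; hence the
    -- isomorphisms `Φ` commute with the arrows.
    by_cases hb : Between deg (d (e i)) a b
    · rw [h.comp_eq hb]
      have : (W i).map f = 𝟙 (Y (e i)) := if_pos hb
      rw [this]
      exact Category.id_comp _
    · rw [h.comp_eq_zero hb]
      have : (W i).map f = 0 := principalNet_map_eq_zero _ f hb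
      rw [this]
      exact zero_comp.trans comp_zero.symm
  refine ⟨_, W, fun i => ⟨isLinkedNet_principalNet hdeg k _ _, exactNet_principalNet hdeg _ _,
    locallyFiniteNet_principalNet hdeg _ _, fun _ => hY (e i)⟩, ⟨fun a => (Φ a).symm, fun f => ?_⟩⟩
  change V.map f ≫ (Φ _).inv = (Φ _).inv ≫ biproduct.map (fun i => (W i).map f)
  rw [Iso.eq_inv_comp, ← Category.assoc, ← hcomm, Category.assoc, Iso.hom_inv_id, Category.comp_id]

end Net

end LinkedNets

open LinkedNets
theorem mainTheorem3 {k : Type*} [Field k] {A : Type*} [Category* A] [Abelian A] [Linear k A]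
    (hA : SemisimpleCategory A)
    {Q : Type*} [Quiver Q] (S : ZStructure Q 1)
    (V : Q ⥤q A) (hV : IsLinkedNet S k V) (hexact : ExactNet S V) (hfin : LocallyFiniteNet V) :
    ∃ (m : ℕ) (W : Fin m → (Q ⥤q A)),
      (∀ i, IsLinkedNet S k (W i) ∧ ExactNet S (W i) ∧ LocallyFiniteNet (W i) ∧ SimpleNet (W i)) ∧
      Nonempty (RepIso V (directSum W)) := by
  exact exists_repIso_directSum hA S V hV hexact hfin
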